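/- A variety over a field $k$ is an integral scheme that is separated and of finite type over $k$; $K(X)$ denotes the function field of an integral scheme $X$. Let $k$ be a field of characteristic $p>0$ and let $X$ be a variety over $k$ such that $k$ is algebraically closed in $K(X)$. An elemental extension $(k\subset l\subset k',\ \varphi:X'\to X)$ of $(k,X)$ consists of field extensions $k\subset l\subset k'$ and a morphism of schemes $\varphi:X'\to X$ such that: $k\subset l$ is purely inseparable with $l^p\subset k$, and $X\times_k l$ is an integral scheme; $X'$ is equipped with a morphism $X'\to X\times_k l$ which is the normalisation of $X\times_k l$; $\varphi$ is the composite $X'\to X\times_k l\to X$; and $k'$ is the algebraic closure of $l$ in $K(X')$. Its internal degree is $[l:k]$ (possibly infinite) and its external degree is $[k':l]$. Proposition. Let $k_Y$ be a field of characteristic $p>0$ and let $f:X\to Y$ be a smooth $k_Y$-morphism of normal varieties over $k_Y$ such that $k_Y$ is algebraically closed in $K(Y)$. Let $k_X$ be the algebraic closure of $k_Y$ in $K(X)$ (so that $X$ is naturally a scheme over $k_X$). Let $(k_Y\subset l_Y\subset k'_Y,\ \psi:Y'\to Y)$ be an elemental extension of $(k_Y,Y)$. Set $l_X:=l_Y\otimes_{k_Y}k_X$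 and $X':=Y'\times_Y X$. Then the following hold. (1) $l_X$ and $k'_Y\otimes_{k_Y}k_X$ are fields. (2) $X\times_{k_X}l_X$ is an integral scheme, and the induced morphism $X'\to X\times_{k_X}l_X$ is the normalisation of $X\times_{k_X}l_X$. (3) $(k_X\subset l_X\subset k'_X,\ \varphi:X'\to X)$ is an elemental extension of $(k_X,X)$, where $\varphi$ is the projection and $k'_X$ is the algebraic closure of $l_X$ in $K(X')$. (4) $[l_X:k_X]=[l_Y:k_Y]$ and $[k'_X:l_X]\ge[k'_Y:l_Y]$. (5) If $Y\times_{k_Y}l_Y$ is normal, then $X\times_{k_X}l_X$ is normal. (6) If $f$ is surjective and $X\times_{k_X}l_X$ is normal, then $Y\times_{k_Y}l_Y$ is normal. -/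

import Mathlib

open AlgebraicGeometry CategoryTheory CategoryTheory.Limits
open scoped TensorProduct

universe u

namespace Elemental

noncomputable section

/-- The morphism `Spec S ⟶ Spec R` attached to an `R`-algebra `S`. -/
abbrev specMap (R S : Type u) [CommRing R] [CommRing S] [Algebra R S] :
    Spec (CommRingCat.of S) ⟶ Spec (CommRingCat.of R) :=
  Spec.map (CommRingCat.ofHom (algebraMap R S))

/-- A scheme is normal if all its local rings are integrally closed domains. -/
def IsNormal (X : Scheme.{u}) : Prop :=
  ∀ x : X, IsDomain (X.presheaf.stalk x) ∧ IsIntegrallyClosed (X.presheaf.stalk x)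

/-- A variety over `k`: an integral scheme that is separated and of finite type over `k`. -/
structure IsVariety {k : Type u} [CommRing k] {X : Scheme.{u}}
    (s : X ⟶ Spec (CommRingCat.of k)) : Prop where
  isIntegral : IsIntegral X
  isSeparated : IsSeparated s
  locallyOfFiniteType : LocallyOfFiniteType s
  quasiCompact : QuasiCompact s

/-- The ring homomorphism `k → Γ(X, 𝒪_X) → K(X)` given by a structure morphism `X ⟶ Spec k`. -/
def toFunctionField {k : Type u} [CommRing k] {X : Scheme.{u}} [IsIntegral X]
    (s : X ⟶ Spec (CommRingCat.of k)) : k →+* X.functionField :=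
  ((Scheme.ΓSpecIso (CommRingCat.of k)).inv ≫ s.appTop ≫ X.presheaf.germ ⊤ (genericPoint X) trivial).hom

section Closure

variable {R K : Type u} [CommRing R] [CommRing K]

/-- The set of elements of `K` that are integral over `R` along `g : R →+* K`. When `R` and `K` are
fields, this is the algebraic closure of `R` in `K`. -/
def closureIn (g : R →+* K) : Subring K :=
  letI := g.toAlgebra
  (integralClosure R K).toSubring

theorem mem_closureIn (g : R →+* K) (x : K) : x ∈ closureIn g ↔ g.IsIntegralElem x :=
  Iff.rfl

instance closureInAlgebra (g : R →+* K) : Algebra R (closureIn g) :=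
  (g.codRestrict (closureIn g) fun x =>
    (mem_closureIn g (g x)).2 (g.isIntegralElem_map)).toAlgebra

end Closure

/-- The inclusion `Spec K(Z) ⟶ Z` of the generic point of an integral scheme. -/
abbrev genericInclusion (Z : Scheme.{u}) [IsIntegral Z] : Spec Z.functionField ⟶ Z :=
  Z.fromSpecStalk (genericPoint Z)

instance genericInclusion_quasiCompact (Z : Scheme.{u}) [IsIntegral Z] :
    QuasiCompact (genericInclusion Z) := by
  refine ⟨fun U _ _ => ?_⟩
  have : Subsingleton (Spec Z.functionField) :=
    inferInstanceAs (Subsingleton (PrimeSpectrum Z.functionField))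
  exact (Set.toFinite _).isCompact

/-- `ν : Z' ⟶ Z` is the normalisation of the integral scheme `Z`: up to an isomorphism over `Z`, it
is the relative normalisation of `Z` in its generic point (locally, the spectrum of the integral
closure of the ring in its fraction field). -/
def IsNormalization {Z' Z : Scheme.{u}} [IsIntegral Z] (ν : Z' ⟶ Z) : Prop :=
  ∃ e : Z' ≅ (genericInclusion Z).normalization,
    e.hom ≫ (genericInclusion Z).fromNormalization = ν

/-- `(k ⊆ l ⊆ k', φ : X' ⟶ X)` is an elemental extension of `(k, X)`, where `s : X ⟶ Spec k` is the
structure morphism. The morphism `ν` is the induced one `X' ⟶ X ×ₖ l`, and `ι` is the inclusion of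
`k'` in `K(X')`. -/
structure IsElementalExtension (p : ℕ) {k l k' : Type u} [CommRing k] [CommRing l] [CommRing k']
    [Algebra k l] [Algebra l k'] {X X' : Scheme.{u}} [IsIntegral X] [IsIntegral X']
    (s : X ⟶ Spec (CommRingCat.of k)) (φ : X' ⟶ X) (ν : X' ⟶ pullback s (specMap k l))
    (ι : k' →+* X'.functionField) : Prop where
  /-- The base: `k` is a field of characteristic `p > 0`, and `X` is a variety over `k` such that
  `k` is algebraically closed in `K(X)`. -/
  isField_base : IsField k
  prime : p.Prime
  charP : CharP k p
  isVariety : IsVariety s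
  algClosed : closureIn (toFunctionField s) = (toFunctionField s).range
  /-- `l` and `k'` are fields. -/
  isField_int : IsField l
  isField_top : IsField k'
  /-- `k ⊆ l` is purely inseparable with `l ^ p ⊆ k`, and `X ×ₖ l` is integral. -/
  isPurelyInseparable : IsPurelyInseparable k l
  pow_mem : ∀ x : l, x ^ p ∈ (algebraMap k l).range
  isIntegral_baseChange : IsIntegral (pullback s (specMap k l))
  /-- `X' ⟶ X ×ₖ l` is the normalisation of `X ×ₖ l`. -/
  isNormalization : IsNormalization ν
  /-- `φ` is the induced morphism. -/
  comp_fst : ν ≫ pullback.fst s (specMap k l) = φ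
  /-- `k'` is the algebraic closure of `l` in `K(X')`. -/
  comp_algebraMap :
    ι.comp (algebraMap l k') = toFunctionField (ν ≫ pullback.snd s (specMap k l))
  range_eq : ι.range = closureIn (toFunctionField (ν ≫ pullback.snd s (specMap k l)))

/-- The algebraic closure of `k` in `K(X)`, for a structure morphism `s : X ⟶ Spec k`. -/
abbrev closureInFunctionField {k : Type u} [CommRing k] {X : Scheme.{u}} [IsIntegral X]
    (s : X ⟶ Spec (CommRingCat.of k)) : Subring X.functionField :=
  closureIn (toFunctionField s)

end

end Elemental

/-! Put `Z = Y ×_{kY} lY` and `W = X ×_{kX} lX`. The key fact is that `kX / kY` is separable.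
Locally `X` is étale over a polynomial ring over a normal domain in which `kY` is algebraically
closed. So `K(X)` is separable algebraic over a field in which `kY` is still algebraically closed,
and minimal polynomials over that field of elements algebraic over `kY` have coefficients in `kY`
(`isSeparable_closureInFunctionField`). On the other side, `kY'` has height one over `kY`: its
elements map to `K(Z)`, so their `p`-th powers lie in `K(Y)` and are algebraic over `kY`
(`IsElementalExtension.pow_mem_top`). Separable tensor height one is a field
(`isField_tensorProduct`), whence (1).

Since `W = X ×_{kY} lY = X ×_Y Z`, it is smooth over `Z`, hence reduced, and homeomorphic to `X`,
hence integral. Normalisation commutes with smooth base change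
(`exists_iso_pullback_fromNormalization`), and `Y' ×_Y X = Y' ×_Z W`; this gives (2) and (3). For
(4), the field `lX ⊗_{lY} kY' = kX ⊗_{kY} kY'` embeds in `kX'`. For (5) and (6), normality means
that the normalisation is an isomorphism, a property stable under base change that descends along
smooth surjections. -/

namespace Elemental

/-! ### Étale algebras over normal domains; separable and height-one extensions -/

section CommutativeAlgebra

theorem isIntegrallyClosed_mvPolynomial (R : Type*) [CommRing R] [IsDomain R]
    [IsIntegrallyClosed R] (n : ℕ) : IsIntegrallyClosed (MvPolynomial (Fin n) R) := by
  induction n with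
  | zero => exact .of_equiv (MvPolynomial.isEmptyAlgEquiv R (Fin 0)).symm.toRingEquiv
  | succ n _ => exact .of_equiv (MvPolynomial.finSuccEquiv R n).symm.toRingEquiv

theorem integralClosure_eq_bot_of_algEquiv {k A B : Type*} [CommRing k] [CommRing A] [CommRing B]
    [Algebra k A] [Algebra k B] (e : A ≃ₐ[k] B) (h : integralClosure k A = ⊥) :
    integralClosure k B = ⊥ := by
  refine eq_bot_iff.mpr fun x hx => ?_
  have : e.symm x ∈ integralClosure k A := IsIntegral.map e.symm hx
  rw [h] at this
  obtain ⟨c, hc⟩ := Algebra.mem_bot.mp this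
  exact Algebra.mem_bot.mpr ⟨c, by rw [← e.commutes, hc, e.apply_symm_apply]⟩

theorem integralClosure_polynomial_eq_bot {k A : Type*} [Field k] [CommRing A] [IsDomain A]
    [Algebra k A] (h : integralClosure k A = ⊥) : integralClosure k (Polynomial A) = ⊥ := by
  refine eq_bot_iff.mpr fun f hf => ?_
  have hf' : IsIntegral A f := IsIntegral.tower_top (R := k) hf
  have hdeg : f.natDegree = 0 := by
    by_contra hne
    exact Polynomial.transcendental f hne
      (mem_nonZeroDivisors_of_ne_zero (by simpa using fun h0 => hne (by simp [h0])))
      hf'.isAlgebraic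
  obtain ⟨a, rfl⟩ := Polynomial.natDegree_eq_zero.mp hdeg
  have ha : a ∈ integralClosure k A :=
    (isIntegral_algHom_iff (IsScalarTower.toAlgHom k A (Polynomial A))
      (Polynomial.C_injective)).mp hf
  rw [h] at ha
  obtain ⟨c, rfl⟩ := Algebra.mem_bot.mp ha
  exact Algebra.mem_bot.mpr ⟨c, rfl⟩

theorem integralClosure_mvPolynomial_eq_bot {k A : Type*} [Field k] [CommRing A] [IsDomain A]
    [Algebra k A] (h : integralClosure k A = ⊥) (n : ℕ) :
    integralClosure k (MvPolynomial (Fin n) A) = ⊥ := by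
  induction n with
  | zero =>
    exact integralClosure_eq_bot_of_algEquiv
      ((MvPolynomial.isEmptyAlgEquiv A (Fin 0)).symm.restrictScalars k) h
  | succ n ih =>
    exact integralClosure_eq_bot_of_algEquiv
      ((MvPolynomial.finSuccEquiv A n).symm.restrictScalars k)
      (integralClosure_polynomial_eq_bot ih)

theorem integralClosure_fractionRing_eq_bot {k A F : Type*} [Field k] [CommRing A] [IsDomain A]
    [IsIntegrallyClosed A] [Field F] [Algebra A F] [IsFractionRing A F] [Algebra k A] [Algebra k F]
    [IsScalarTower k A F] (h : integralClosure k A = ⊥) : integralClosure k F = ⊥ := by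
  refine eq_bot_iff.mpr fun x hx => ?_
  obtain ⟨a, rfl⟩ := (isIntegrallyClosed_iff F).mp ‹_› (IsIntegral.tower_top (A := A) hx)
  have ha : a ∈ integralClosure k A :=
    (isIntegral_algHom_iff (IsScalarTower.toAlgHom k A F) (IsFractionRing.injective A F)).mp hx
  rw [h] at ha
  obtain ⟨c, rfl⟩ := Algebra.mem_bot.mp ha
  exact Algebra.mem_bot.mpr ⟨c, IsScalarTower.algebraMap_apply k A F c⟩

/-- If `k` is algebraically closed in `F`, an element algebraic over `k` and separable over `F` is
separable over `k`. -/
theorem isSeparable_of_integralClosure_eq_bot {k F L : Type*} [Field k] [Field F] [Field L]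
    [Algebra k F] [Algebra F L] [Algebra k L] [IsScalarTower k F L]
    (h : integralClosure k F = ⊥) {x : L} (hx : IsIntegral k x) (hs : IsSeparable F x) :
    IsSeparable k x := by
  have hxF : IsIntegral F x := hx.tower_top
  have hd : minpoly F x ∣ (minpoly k x).map (algebraMap k F) := minpoly.dvd_map_of_isScalarTower k F x
  -- A monic factor over `F` of a monic polynomial over `k` has coefficients integral over `k`, so
  -- here in `k`.
  obtain ⟨q, hq⟩ := integralClosure.mem_lifts_of_monic_of_dvd_map F (minpoly.monic hx)
    (minpoly.monic hxF) hd
  have hq : q.map (algebraMap (integralClosure k F) F) = minpoly F x := hq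
  have hlift : minpoly F x ∈ Polynomial.lifts (algebraMap k F) := by
    rw [Polynomial.lifts_iff_coeff_lifts]
    intro n
    have h1 : (q.coeff n : F) ∈ integralClosure k F := (q.coeff n).2
    obtain ⟨c, hc⟩ := Algebra.mem_bot.mp (h.le h1)
    exact ⟨c, by rw [hc, ← hq, Polynomial.coeff_map]; rfl⟩
  obtain ⟨r, hr⟩ := hlift
  have hr : r.map (algebraMap k F) = minpoly F x := hr
  have hrs : r.Separable := by
    rw [← Polynomial.separable_map (algebraMap k F), hr]; exact hs
  have hr0 : Polynomial.aeval x r = 0 := by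
    rw [← Polynomial.aeval_map_algebraMap F, hr, minpoly.aeval]
  exact hrs.of_dvd (minpoly.dvd k x hr0)

/-- By flatness `B` embeds in its generic fibre, which is étale over a field. -/
theorem isReduced_of_etale (P B : Type*) [CommRing P] [IsDomain P] [CommRing B] [Algebra P B]
    [Algebra.Etale P B] : IsReduced B := by
  let K := FractionRing P
  have : IsReduced (K ⊗[P] B) := Algebra.FormallyUnramified.isReduced_of_field K (K ⊗[P] B)
  have hinj : Function.Injective (Algebra.TensorProduct.includeRight : B →ₐ[P] K ⊗[P] B) :=
    Algebra.TensorProduct.includeRight_injective (IsFractionRing.injective P K)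
  exact isReduced_of_injective (Algebra.TensorProduct.includeRight : B →ₐ[P] K ⊗[P] B) hinj

/-- The generic fibre `B ⊗ K` is a domain finite over `K`, hence a field, hence the fraction field
of `B`. Integral closure commutes with smooth base change, so that of `B` in `B ⊗ K` is `B ⊗ P = B`.
-/
theorem isIntegrallyClosed_of_etale (P B : Type*) [CommRing P] [IsDomain P] [IsIntegrallyClosed P]
    [CommRing B] [IsDomain B] [Algebra P B] [Algebra.Etale P B] : IsIntegrallyClosed B := by
  let K := FractionRing P
  have hle : Algebra.algebraMapSubmonoid B (nonZeroDivisors P) ≤ nonZeroDivisors B := by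
    rintro _ ⟨a, ha, rfl⟩
    have : Function.Injective (algebraMap P B) := FaithfulSMul.algebraMap_injective P B
    exact mem_nonZeroDivisors_of_ne_zero
      ((map_ne_zero_iff _ this).mpr (nonZeroDivisors.ne_zero ha))
  have hloc : IsLocalization (Algebra.algebraMapSubmonoid B (nonZeroDivisors P)) (B ⊗[P] K) :=
    IsLocalization.tensor K (nonZeroDivisors P)
  have hdom : IsDomain (B ⊗[P] K) := IsLocalization.isDomain_of_le_nonZeroDivisors _ hle
  have hfin : Module.Finite K (K ⊗[P] B) := Algebra.FormallyUnramified.finite_of_free K (K ⊗[P] B)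
  have hdom' : IsDomain (K ⊗[P] B) :=
    (Algebra.TensorProduct.comm P K B).toRingEquiv.toMulEquiv.isDomain _
  have hfield : IsField (K ⊗[P] B) :=
    isField_of_isIntegral_of_isField' (R := K) (Field.toIsField K)
  have hfield' : IsField (B ⊗[P] K) :=
    (Algebra.TensorProduct.comm P B K).toRingEquiv.toMulEquiv.isField hfield
  have hfrac : IsFractionRing B (B ⊗[P] K) := by
    refine IsLocalization.of_le _ _ hle fun r hr => ?_
    let := hfield'.toField
    refine Ne.isUnit ?_
    exact (map_ne_zero_iff _ (IsLocalization.injective _ hle)).mpr (nonZeroDivisors.ne_zero hr)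
  refine (isIntegrallyClosed_iff (B ⊗[P] K)).mpr fun {x} hx => ?_
  obtain ⟨y, hy⟩ := (TensorProduct.toIntegralClosure_bijective_of_smooth (R := P) (S := B)
    (B := K)).2 ⟨x, hx⟩
  have key : ∀ y : B ⊗[P] integralClosure P K, ∃ b : B,
      algebraMap B (B ⊗[P] K) b = TensorProduct.toIntegralClosure P B K y := by
    intro y
    induction y with
    | zero => exact ⟨0, by simp⟩
    | add y z hy hz =>
      obtain ⟨b, hb⟩ := hy
      obtain ⟨c, hc⟩ := hz
      exact ⟨b + c, by rw [map_add, map_add, hb, hc]; rfl⟩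
    | tmul b z =>
      obtain ⟨c, hc⟩ := (isIntegrallyClosed_iff K).mp ‹IsIntegrallyClosed P› z.2
      refine ⟨c • b, ?_⟩
      change (c • b) ⊗ₜ[P] (1 : K) = b ⊗ₜ[P] (z : K)
      rw [TensorProduct.smul_tmul, ← hc, Algebra.smul_def, mul_one]
  obtain ⟨b, hb⟩ := key y
  exact ⟨b, by rw [hb, hy]⟩

theorem isReduced_of_isStandardSmooth {A B : Type*} [CommRing A] [IsDomain A] [CommRing B]
    {f : A →+* B} (hf : f.IsStandardSmooth) : IsReduced B := by
  obtain ⟨n, g, -, hg⟩ := hf.exists_etale_mvPolynomial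
  algebraize [g]
  exact isReduced_of_etale (MvPolynomial (Fin n) A) B

theorem isIntegrallyClosed_of_isStandardSmooth {A B : Type*} [CommRing A] [IsDomain A]
    [IsIntegrallyClosed A] [CommRing B] [IsDomain B] {f : A →+* B} (hf : f.IsStandardSmooth) :
    IsIntegrallyClosed B := by
  obtain ⟨n, g, -, hg⟩ := hf.exists_etale_mvPolynomial
  algebraize [g]
  have := isIntegrallyClosed_mvPolynomial A n
  exact isIntegrallyClosed_of_etale (MvPolynomial (Fin n) A) B

/-- Elements of the fraction field of a smooth algebra over a normal domain `A` that are algebraic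
over a field `k` which is algebraically closed in `A` are separable over `k`. -/
theorem isSeparable_of_isStandardSmooth {k A B L : Type*} [Field k] [CommRing A] [IsDomain A]
    [IsIntegrallyClosed A] [CommRing B] [IsDomain B] [Field L] [Algebra k A] [Algebra A B]
    [Algebra B L] [IsFractionRing B L] [Algebra k L]
    (hcomp : (algebraMap B L).comp ((algebraMap A B).comp (algebraMap k A)) = algebraMap k L)
    (hs : (algebraMap A B).IsStandardSmooth) (h : integralClosure k A = ⊥) {x : L}
    (hx : IsIntegral k x) : IsSeparable k x := by
  obtain ⟨n, g, hg, hge⟩ := hs.exists_etale_mvPolynomial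
  have := isIntegrallyClosed_mvPolynomial A n
  algebraize [g]
  let P := MvPolynomial (Fin n) A
  let F := FractionRing P
  let : Algebra P L := ((algebraMap B L).comp g).toAlgebra
  have : IsScalarTower P B L := .of_algebraMap_eq' rfl
  have hinj : Function.Injective (algebraMap P L) :=
    (IsFractionRing.injective B L).comp (FaithfulSMul.algebraMap_injective P B)
  have : FaithfulSMul P L := (faithfulSMul_iff_algebraMap_injective P L).mpr hinj
  let : Algebra F L := FractionRing.liftAlgebra P L
  have : IsScalarTower P F L := FractionRing.isScalarTower_liftAlgebra P L
  have : IsScalarTower k F L := .of_algebraMap_eq' <| by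
    rw [IsScalarTower.algebraMap_eq k P F, ← RingHom.comp_assoc, ← IsScalarTower.algebraMap_eq P F L,
      ← hcomp, ← hg]
    rfl
  -- `L` is a localisation of an étale `P`-algebra, so it is unramified and essentially of finite
  -- type over `F`, hence separable.
  have : Algebra.FormallyEtale B L := .of_isLocalization (nonZeroDivisors B)
  have : Algebra.FormallyEtale P L := .comp P B L
  have : Algebra.FormallyUnramified F L := .of_restrictScalars P F L
  have : Algebra.EssFiniteType B L := .of_isLocalization _ (nonZeroDivisors B)
  have : Algebra.EssFiniteType P L := .comp P B L
  have : Algebra.EssFiniteType F L := .of_comp P F L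
  have := Algebra.FormallyUnramified.isSeparable F L
  exact isSeparable_of_integralClosure_eq_bot
    (integralClosure_fractionRing_eq_bot (A := P) (F := F)
      (integralClosure_mvPolynomial_eq_bot h n)) hx (Algebra.IsSeparable.isSeparable F x)

/-- Frobenius is additive, and in `a ^ p ⊗ m ^ p` the right factor is a scalar. -/
theorem exists_pow_tensorProduct {p : ℕ} [Fact p.Prime] {k E M : Type*} [Field k] [CharP k p]
    [CommRing E] [CommRing M] [Algebra k E] [Algebra k M]
    (hM : ∀ m : M, m ^ p ∈ (algebraMap k M).range) (z : E ⊗[k] M) :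
    ∃ e : E, e ⊗ₜ[k] (1 : M) = z ^ p := by
  induction z with
  | zero => exact ⟨0, by simp [(Fact.out : p.Prime).ne_zero]⟩
  | add x y hx hy =>
    obtain ⟨a, ha⟩ := hx
    obtain ⟨b, hb⟩ := hy
    refine ⟨a + b, ?_⟩
    rcases subsingleton_or_nontrivial (E ⊗[k] M) with _ | _
    · exact Subsingleton.elim _ _
    have : CharP (E ⊗[k] M) p := charP_of_injective_algebraMap (algebraMap k (E ⊗[k] M)).injective p
    rw [add_pow_char, TensorProduct.add_tmul, ha, hb]
  | tmul a m =>
    obtain ⟨c, hc⟩ := hM m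
    refine ⟨c • a ^ p, ?_⟩
    rw [Algebra.TensorProduct.tmul_pow, ← hc, TensorProduct.smul_tmul, Algebra.smul_def, mul_one]

/-- The tensor product of a separable algebraic extension with an extension of height one is
a field. -/
theorem isField_tensorProduct {p : ℕ} [Fact p.Prime] {k E M : Type*} [Field k] [CharP k p] [Field E]
    [Field M] [Algebra k E] [Algebra k M] [Algebra.IsSeparable k E]
    (hM : ∀ m : M, m ^ p ∈ (algebraMap k M).range) : IsField (E ⊗[k] M) := by
  have hp : p.Prime := Fact.out
  -- Expand `z` in a `k`-basis of `E`: separability keeps the `p`-th powers of the basis linearly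
  -- independent, so `z ^ p = 0` kills every coefficient.
  have hred : ∀ z : E ⊗[k] M, z ^ p = 0 → z = 0 := by
    intro z hz
    let b := Module.Basis.ofVectorSpace k E
    obtain ⟨c, rfl⟩ := TensorProduct.eq_repr_basis_left b z
    have : CharP (E ⊗[k] M) p := charP_of_injective_algebraMap (algebraMap k (E ⊗[k] M)).injective p
    choose g hg using hM
    have h1 : (c.support.sum fun i => g (c i) • b i ^ p) ⊗ₜ[k] (1 : M) = 0 := by
      rw [← hz, Finsupp.sum, sum_pow_char, TensorProduct.sum_tmul]
      refine Finset.sum_congr rfl fun i _ => ?_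
      rw [Algebra.TensorProduct.tmul_pow, ← hg, TensorProduct.smul_tmul, Algebra.smul_def, mul_one]
    have h2 : (c.support.sum fun i => g (c i) • b i ^ p) = 0 :=
      (Algebra.TensorProduct.includeLeft_injective (S := k)
        (algebraMap k M).injective)
        (h1.trans (TensorProduct.zero_tmul _ _).symm)
    have hexp : ExpChar k p := .prime hp
    have hli := b.linearIndependent.map_pow_expChar_pow_of_isSeparable p 1
    have h3 := linearIndependent_iff'.mp hli c.support (fun i => g (c i)) (by simpa using h2)
    refine Finset.sum_eq_zero fun i hi => ?_
    have : c i ^ p = 0 := by rw [← hg, h3 i hi, map_zero]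
    exact (congrArg _ (pow_eq_zero_iff hp.ne_zero |>.mp this)).trans (TensorProduct.tmul_zero _ _)
  refine ⟨exists_pair_ne _, mul_comm, fun {z} hz => ?_⟩
  obtain ⟨e, he⟩ := exists_pow_tensorProduct hM z
  have he0 : e ≠ 0 := by
    rintro rfl
    exact hz (hred z (by rw [← he, TensorProduct.zero_tmul]))
  -- The inverse comes from `z ^ p = e ⊗ 1` with `e` a unit.
  refine ⟨z ^ (p - 1) * (e⁻¹ ⊗ₜ 1), ?_⟩
  rw [← mul_assoc, ← pow_succ', Nat.sub_add_cancel hp.one_le, ← he, Algebra.TensorProduct.tmul_mul_tmul,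
    mul_inv_cancel₀ he0, mul_one, Algebra.TensorProduct.one_def]

/-- The elements of `K` whose `p`-th power lies in the subfield `k`. -/
def powSubfield (p : ℕ) [Fact p.Prime] {k K : Type*} [Field k] [Field K] [CharP K p]
    (g : k →+* K) : Subfield K where
  toSubring := g.range.comap (frobenius K p)
  inv_mem' x := by
    rintro ⟨a, ha⟩
    exact ⟨a⁻¹, by rw [map_inv₀, ha, map_inv₀]⟩

theorem mem_powSubfield {p : ℕ} [Fact p.Prime] {k K : Type*} [Field k] [Field K] [CharP K p]
    {g : k →+* K} {x : K} : x ∈ powSubfield p g ↔ x ^ p ∈ g.range :=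
  Iff.rfl

/-- A subfield through which any two homomorphisms out of `K` can be distinguished is everything. -/
theorem Subfield.eq_top_of_epi {K : Type u} [Field K] (F : Subfield K)
    (h : ∀ (C : Type u) [CommRing C] (a b : K →+* C),
      a.comp F.subtype = b.comp F.subtype → a = b) : F = ⊤ := by
  refine eq_top_iff.mpr fun x _ => ?_
  have hab := h (K ⊗[F] K) (Algebra.TensorProduct.includeLeftRingHom)
    (Algebra.TensorProduct.includeRight : K →ₐ[F] K ⊗[F] K).toRingHom (by
      ext y
      exact (Algebra.TensorProduct.includeLeft (R := F) (S := F) (A := K) (B := K)).commutes y |>.trans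
        ((Algebra.TensorProduct.includeRight : K →ₐ[F] K ⊗[F] K).commutes y).symm)
  by_contra hx
  -- If `x ∉ F`, an `F`-linear form killing `1` but not `x`, applied to the left factor, separates
  -- `x ⊗ 1` from `1 ⊗ x`.
  obtain ⟨φ, hφx, hφ⟩ := Submodule.exists_le_ker_of_notMem
    (p := Submodule.span F {(1 : K)}) (v := x) (by
      rw [Submodule.mem_span_singleton]
      rintro ⟨a, rfl⟩
      exact hx (by simp [Subfield.smul_def]))
  have hφ1 : φ 1 = 0 := hφ (Submodule.mem_span_singleton_self _)
  have hx' : x ⊗ₜ[F] (1 : K) = (1 : K) ⊗ₜ[F] x := DFunLike.congr_fun hab x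
  have h2 := congrArg (TensorProduct.lift ((LinearMap.lsmul F K).comp φ)) hx'
  simp only [TensorProduct.lift.tmul, LinearMap.comp_apply, LinearMap.lsmul_apply, hφ1,
    zero_smul] at h2
  exact hφx (by simpa using h2)

end CommutativeAlgebra
-- Normal schemes and their normalisation
section Normality

theorem specMap_toFunctionField {k : Type u} [CommRing k] {X : Scheme.{u}} [IsIntegral X]
    (s : X ⟶ Spec (CommRingCat.of k)) :
    Spec.map (CommRingCat.ofHom (toFunctionField s)) = genericInclusion X ≫ s := by
  have h : s = X.toSpecΓ ≫ Spec.map ((Scheme.ΓSpecIso (CommRingCat.of k)).inv ≫ s.appTop) := by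
    rw [Spec.map_comp, ← Scheme.toSpecΓ_naturality_assoc]
    simp
  conv_rhs => rw [h, Scheme.fromSpecStalk_toSpecΓ_assoc, ← Spec.map_comp]
  rw [Category.assoc]
  rfl

theorem isReduced_of_smooth {W Z : Scheme.{u}} [IsIntegral Z] (g : W ⟶ Z) [Smooth g] :
    IsReduced W := by
  have (x : W) : _root_.IsReduced (W.presheaf.stalk x) := by
    obtain ⟨U, hU, V, hV, hx, e, hs⟩ := Smooth.exists_isStandardSmooth g x
    have : Nonempty U := ⟨⟨g x, e hx⟩⟩
    have := isReduced_of_isStandardSmooth hs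
    let : Algebra Γ(W, V) (W.presheaf.stalk x) :=
      TopCat.Presheaf.algebra_section_stalk W.presheaf (⟨x, hx⟩ : V)
    have : IsLocalization.AtPrime (W.presheaf.stalk x) (hV.primeIdealOf ⟨x, hx⟩).asIdeal :=
      hV.isLocalization_stalk ⟨x, hx⟩
    exact isReduced_localizationPreserves (hV.primeIdealOf ⟨x, hx⟩).asIdeal.primeCompl _ ‹_›
  exact isReduced_of_isReduced_stalk W

theorem isNormal_of_affine {Z : Scheme.{u}} [IsIntegral Z]
    (h : ∀ x : Z, ∃ U : Z.Opens, IsAffineOpen U ∧ x ∈ U ∧ IsIntegrallyClosed Γ(Z, U)) :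
    IsNormal Z := by
  intro x
  obtain ⟨U, hU, hx, hc⟩ := h x
  have : Nonempty U := ⟨⟨x, hx⟩⟩
  let : Algebra Γ(Z, U) (Z.presheaf.stalk x) :=
    TopCat.Presheaf.algebra_section_stalk Z.presheaf (⟨x, hx⟩ : U)
  have : IsLocalization.AtPrime (Z.presheaf.stalk x) (hU.primeIdealOf ⟨x, hx⟩).asIdeal :=
    hU.isLocalization_stalk ⟨x, hx⟩
  exact ⟨inferInstance, isIntegrallyClosed_of_isLocalization _
    (hU.primeIdealOf ⟨x, hx⟩).asIdeal.primeCompl (Ideal.primeCompl_le_nonZeroDivisors _)⟩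

theorem IsNormal.isIntegrallyClosed {Z : Scheme.{u}} [IsIntegral Z] (h : IsNormal Z)
    {U : Z.Opens} (hU : IsAffineOpen U) [Nonempty U] : IsIntegrallyClosed Γ(Z, U) := by
  refine IsIntegrallyClosed.of_localization_maximal fun P _ _ => ?_
  let y : PrimeSpectrum Γ(Z, U) := ⟨P, inferInstance⟩
  have hy : hU.fromSpec y ∈ U := by
    have := Set.mem_range_self (f := hU.fromSpec) y
    rwa [hU.range_fromSpec] at this
  let : Algebra Γ(Z, U) (Z.presheaf.stalk (hU.fromSpec y)) :=
    TopCat.Presheaf.algebra_section_stalk Z.presheaf ⟨hU.fromSpec y, hy⟩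
  have hloc : IsLocalization.AtPrime (Z.presheaf.stalk (hU.fromSpec y)) P :=
    hU.isLocalization_stalk' y hy
  have := (h (hU.fromSpec y)).2
  exact .of_equiv (IsLocalization.algEquiv P.primeCompl (Z.presheaf.stalk (hU.fromSpec y))
    (Localization.AtPrime P)).toRingEquiv

theorem isNormal_of_smooth {W Z : Scheme.{u}} [IsIntegral Z] [IsIntegral W] (hZ : IsNormal Z)
    (g : W ⟶ Z) [Smooth g] : IsNormal W := by
  refine isNormal_of_affine fun x => ?_
  obtain ⟨U, hU, V, hV, hx, e, hs⟩ := Smooth.exists_isStandardSmooth g x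
  have : Nonempty U := ⟨⟨g x, e hx⟩⟩
  have : Nonempty V := ⟨⟨x, hx⟩⟩
  have := hZ.isIntegrallyClosed hU
  exact ⟨V, hV, hx, isIntegrallyClosed_of_isStandardSmooth hs⟩

theorem isNormal_spec (K : CommRingCat.{u}) [IsDomain K] [IsIntegrallyClosed K] :
    IsNormal (Spec K) :=
  isNormal_of_affine fun _ => ⟨⊤, isAffineOpen_top _, trivial,
    .of_equiv (Scheme.ΓSpecIso K).commRingCatIsoToRingEquiv.symm⟩

/-- `S` is a copy of the fraction field: sections over the preimage of an affine open are only
isomorphic to `K(Z)`. -/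
theorem bijective_algebraMap_integralClosure_iff {A S K : Type*} [CommRing A] [CommRing S] [Field K]
    [Algebra A S] [Algebra A K] [IsDomain A] [IsFractionRing A K] (e : K ≃ₐ[A] S) :
    Function.Bijective (algebraMap A (integralClosure A S)) ↔ IsIntegrallyClosed A := by
  rw [isIntegrallyClosed_iff K]
  constructor
  · intro h x hx
    obtain ⟨a, ha⟩ := h.2 ⟨e x, hx.map e⟩
    refine ⟨a, e.injective ?_⟩
    rw [e.commutes]
    exact congrArg Subtype.val ha
  · intro h
    refine ⟨fun a b hab => IsFractionRing.injective A K (e.injective ?_), fun ⟨s, hs⟩ => ?_⟩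
    · rw [e.commutes, e.commutes]
      exact congrArg Subtype.val hab
    · obtain ⟨a, ha⟩ := h (IsIntegral.map e.symm hs)
      refine ⟨a, Subtype.ext ?_⟩
      change algebraMap A S a = s
      rw [← e.commutes, ha, e.apply_symm_apply]

theorem isIso_fromNormalization_app_iff {Z : Scheme.{u}} [IsIntegral Z] {U : Z.Opens}
    (hU : IsAffineOpen U) [hne : Nonempty U] :
    IsIso ((genericInclusion Z).fromNormalization.app U) ↔ IsIntegrallyClosed Γ(Z, U) := by
  let : Algebra Γ(Z, U) Γ(Spec Z.functionField, genericInclusion Z ⁻¹ᵁ U) :=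
    ((genericInclusion Z).app U).hom.toAlgebra
  have hη : genericPoint Z ∈ U :=
    ((genericPoint_spec Z).mem_open_set_iff U.isOpen).mpr (by simpa using hne)
  have htop : genericInclusion Z ⁻¹ᵁ U = ⊤ := by
    refine top_le_iff.mp fun y _ => ?_
    have : y = IsLocalRing.closedPoint Z.functionField :=
      Subsingleton.elim (α := PrimeSpectrum _) _ _
    subst this
    change genericInclusion Z _ ∈ U
    rwa [Scheme.fromSpecStalk_closedPoint]
  have : IsFractionRing Γ(Z, U) Z.functionField :=
    functionField_isFractionRing_of_isAffineOpen _ U hU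
  let i : Z.functionField ≅ Γ(Spec Z.functionField, genericInclusion Z ⁻¹ᵁ U) :=
    (Scheme.ΓSpecIso Z.functionField).symm ≪≫
      (Spec Z.functionField).presheaf.mapIso (eqToIso htop).op
  let e : Z.functionField ≃ₐ[Γ(Z, U)] Γ(Spec Z.functionField, genericInclusion Z ⁻¹ᵁ U) :=
    { i.commRingCatIsoToRingEquiv with
      commutes' := fun a => by
        change (Z.presheaf.germ U (genericPoint Z) hη ≫ i.hom) a = (genericInclusion Z).app U a
        rw [Scheme.fromSpecStalk_app hη]
        rfl }
  rw [Scheme.Hom.fromNormalization_app _ hU, ← bijective_algebraMap_integralClosure_iff e,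
    isIso_comp_right_iff, ConcreteCategory.isIso_iff_bijective]
  rfl

theorem isIso_fromNormalization_iff {Z : Scheme.{u}} [IsIntegral Z] :
    IsIso (genericInclusion Z).fromNormalization ↔ IsNormal Z := by
  constructor
  · intro h
    refine isNormal_of_affine fun x => ?_
    obtain ⟨_, ⟨U, hU, rfl⟩, hxU, -⟩ :=
      Z.isBasis_affineOpens.exists_subset_of_mem_open (Set.mem_univ x) isOpen_univ
    have : Nonempty U := ⟨⟨x, hxU⟩⟩
    exact ⟨U, hU, hxU, (isIso_fromNormalization_app_iff hU).mp inferInstance⟩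
  · intro h
    refine IsZariskiLocalAtTarget.of_forall_exists_morphismRestrict (P := .isomorphisms _)
      fun x => ?_
    obtain ⟨_, ⟨U, hU, rfl⟩, hxU, -⟩ :=
      Z.isBasis_affineOpens.exists_subset_of_mem_open (Set.mem_univ x) isOpen_univ
    have : Nonempty U := ⟨⟨x, hxU⟩⟩
    exact ⟨U, hxU, (isIso_morphismRestrict_iff_isIso_app _ hU).mpr
      ((isIso_fromNormalization_app_iff hU).mpr (h.isIntegrallyClosed hU))⟩

theorem IsNormalization.isIso_iff {Z' Z : Scheme.{u}} [IsIntegral Z] {ν : Z' ⟶ Z}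
    (h : IsNormalization ν) : IsIso ν ↔ IsNormal Z := by
  obtain ⟨e, rfl⟩ := h
  rw [isIso_comp_left_iff, isIso_fromNormalization_iff]

end Normality

/-! ### Generic points and flat morphisms -/

section GenericPoint

instance flat_fromSpecStalk (Z : Scheme.{u}) (x : Z) : Flat (Z.fromSpecStalk x) := by
  obtain ⟨_, ⟨U, hU, rfl⟩, hxU, -⟩ :=
    Z.isBasis_affineOpens.exists_subset_of_mem_open (Set.mem_univ x) isOpen_univ
  rw [← hU.fromSpecStalk_eq_fromSpecStalk hxU]
  let : Algebra Γ(Z, U) (Z.presheaf.stalk x) :=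
    TopCat.Presheaf.algebra_section_stalk Z.presheaf (⟨x, hxU⟩ : U)
  have : IsLocalization.AtPrime (Z.presheaf.stalk x) (hU.primeIdealOf ⟨x, hxU⟩).asIdeal :=
    hU.isLocalization_stalk ⟨x, hxU⟩
  have h : Flat (Spec.map (Z.presheaf.germ U x hxU)) := by
    rw [Flat.SpecMap_iff]
    exact IsLocalization.flat (Z.presheaf.stalk x) (hU.primeIdealOf ⟨x, hxU⟩).asIdeal.primeCompl
  exact MorphismProperty.comp_mem @Flat (Spec.map (Z.presheaf.germ U x hxU)) hU.fromSpec h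
    (have := hU.isOpenImmersion_fromSpec; inferInstance)

/-- The stalk map at the generic point is faithfully flat into a field, so its source has a single
prime, and every generisation of the image point is that point itself. -/
theorem map_genericPoint_of_flat {V W : Scheme.{u}} [IsIntegral V] [IsIntegral W] (f : V ⟶ W)
    [Flat f] : f (genericPoint V) = genericPoint W := by
  set ξ := genericPoint V
  have hflat := Flat.stalkMap f ξ
  algebraize [(f.stalkMap ξ).hom]
  have : Module.FaithfullyFlat (W.presheaf.stalk (f ξ)) (V.presheaf.stalk ξ) :=
    @Module.FaithfullyFlat.of_flat_of_isLocalHom _ _ _ _ _ _ _ hflat (f.toLRSHom.prop ξ)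
  have hsurj := PrimeSpectrum.comap_surjective_of_faithfullyFlat (A := W.presheaf.stalk (f ξ))
    (B := V.presheaf.stalk ξ)
  have : Subsingleton (PrimeSpectrum (V.presheaf.stalk ξ)) :=
    inferInstanceAs (Subsingleton (PrimeSpectrum V.functionField))
  have hsub : Subsingleton (PrimeSpectrum (W.presheaf.stalk (f ξ))) := hsurj.subsingleton
  obtain ⟨y, hy⟩ : genericPoint W ∈ Set.range (W.fromSpecStalk (f ξ)) := by
    rw [Scheme.range_fromSpecStalk]
    exact (genericPoint_spec W).specializes trivial
  exact (Scheme.fromSpecStalk_closedPoint (x := f ξ)).symm.trans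
    ((congrArg _ (hsub.elim _ _)).trans hy)

/-- The map of function fields induced by a morphism preserving generic points. -/
theorem exists_functionField_map {V W : Scheme.{u}} [IsIntegral V] [IsIntegral W] (f : V ⟶ W)
    (h : f (genericPoint V) = genericPoint W) :
    ∃ ψ : W.functionField ⟶ V.functionField,
      Spec.map ψ ≫ genericInclusion W = genericInclusion V ≫ f := by
  have hs : f (genericPoint V) ⤳ genericPoint W := by rw [h]
  refine ⟨W.presheaf.stalkSpecializes hs ≫ f.stalkMap (genericPoint V), ?_⟩
  rw [Spec.map_comp, Category.assoc, Scheme.SpecMap_stalkSpecializes_fromSpecStalk,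
    Scheme.SpecMap_stalkMap_fromSpecStalk]

theorem exists_iso_functionField_of_flat_of_mono {V W : Scheme.{u}} [IsIntegral V] [IsIntegral W]
    (j : V ⟶ W) [Flat j] [Mono j] :
    ∃ φ : Spec W.functionField ≅ Spec V.functionField,
      φ.hom ≫ genericInclusion V ≫ j = genericInclusion W := by
  obtain ⟨ψ, hψ⟩ := exists_functionField_map j (map_genericPoint_of_flat j)
  have : Mono (Spec.map ψ) := by
    have : Mono (Spec.map ψ ≫ genericInclusion W) := hψ ▸ inferInstance
    exact mono_of_mono _ (genericInclusion W)
  have : Flat (Spec.map ψ) := by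
    rw [Flat.SpecMap_iff]
    let : Algebra W.functionField V.functionField := ψ.hom.toAlgebra
    exact inferInstanceAs (Module.Flat W.functionField V.functionField)
  have : Surjective (Spec.map ψ) :=
    ⟨fun x => ⟨genericPoint _, Subsingleton.elim (α := PrimeSpectrum W.functionField) _ _⟩⟩
  have := Flat.isIso_of_surjective_of_mono (Spec.map ψ)
  exact ⟨(asIso (Spec.map ψ)).symm, by simp [← hψ]⟩

end GenericPoint

/-! ### Normalisation and smooth base change -/

section Normalization

instance isDominant_genericInclusion (Z : Scheme.{u}) [IsIntegral Z] :
    IsDominant (genericInclusion Z) := by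
  refine ⟨(dense_iff_closure_eq.mpr ?_ : Dense {genericPoint Z}).mono ?_⟩
  · exact (genericPoint_spec Z).def
  · rintro _ rfl
    exact ⟨_, Scheme.fromSpecStalk_closedPoint⟩

/-- The relative normalisation of `W` along `j : V ⟶ W` with `V` normal agrees with the relative
normalisation in the generic point of `V`. -/
theorem exists_iso_normalization {T S V W : Scheme.{u}} (η : T ⟶ V) (j : V ⟶ W) (φ : S ≅ T)
    (f : S ⟶ W) (hf : φ.hom ≫ η ≫ j = f) [QuasiCompact η] [QuasiSeparated η] [IsDominant η]
    [QuasiCompact j] [QuasiSeparated j] [QuasiCompact f] [QuasiSeparated f] [IsReduced V]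
    [IsReduced S] [IsIso η.fromNormalization] :
    ∃ e : j.normalization ≅ f.normalization, e.hom ≫ f.fromNormalization = j.fromNormalization := by
  have h1 : f = (φ.hom ≫ η ≫ j.toNormalization) ≫ j.fromNormalization := by simp [hf]
  let a : f.normalization ⟶ j.normalization :=
    f.normalizationDesc (φ.hom ≫ η ≫ j.toNormalization) j.fromNormalization h1
  have hw : η ≫ j = (φ.inv ≫ f.toNormalization) ≫ f.fromNormalization := by simp [← hf]
  let q : T ⟶ pullback j f.fromNormalization := pullback.lift η (φ.inv ≫ f.toNormalization) hw
  have h2 : η = q ≫ pullback.fst j f.fromNormalization := (pullback.lift_fst _ _ _).symm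
  -- `V` is its own normalisation in `T`, so its universal property gives a section of the integral
  -- `V`-scheme obtained by pulling back `f.normalization`.
  let v : V ⟶ f.normalization := inv η.fromNormalization ≫
    η.normalizationDesc q (pullback.fst j f.fromNormalization) h2 ≫ pullback.snd _ _
  have hv : v ≫ f.fromNormalization = j := by
    simp only [v, Category.assoc, ← pullback.condition]
    rw [Scheme.Hom.normalizationDesc_comp_assoc, IsIso.inv_hom_id_assoc]
  have hηv : η ≫ v = φ.inv ≫ f.toNormalization := by
    have : η ≫ inv η.fromNormalization = η.toNormalization := by
      rw [IsIso.comp_inv_eq, Scheme.Hom.toNormalization_fromNormalization]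
    simp only [v, reassoc_of% this, Scheme.Hom.toNormalization_normalizationDesc_assoc, q,
      pullback.lift_snd]
  let b : j.normalization ⟶ f.normalization := j.normalizationDesc v f.fromNormalization hv.symm
  have hb : b ≫ f.fromNormalization = j.fromNormalization := Scheme.Hom.normalizationDesc_comp ..
  have ha : a ≫ j.fromNormalization = f.fromNormalization := Scheme.Hom.normalizationDesc_comp ..
  have hjb : j.toNormalization ≫ b = v := Scheme.Hom.toNormalization_normalizationDesc ..
  have hfa : f.toNormalization ≫ a = φ.hom ≫ η ≫ j.toNormalization :=
    Scheme.Hom.toNormalization_normalizationDesc ..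
  have hva : v ≫ a = j.toNormalization := by
    refine ext_of_isDominant_of_isSeparated j.fromNormalization ?_ η ?_
    · rw [Category.assoc, ha, hv, Scheme.Hom.toNormalization_fromNormalization]
    · rw [reassoc_of% hηv, hfa, Iso.inv_hom_id_assoc]
  refine ⟨⟨b, a, ?_, ?_⟩, hb⟩
  · refine ext_of_isDominant_of_isSeparated j.fromNormalization ?_ j.toNormalization ?_
    · rw [Category.assoc, ha, hb, Category.id_comp]
    · rw [reassoc_of% hjb, hva, Category.comp_id]
  · refine ext_of_isDominant_of_isSeparated f.fromNormalization ?_ f.toNormalization ?_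
    · rw [Category.assoc, hb, ha, Category.id_comp]
    · rw [reassoc_of% hfa, hjb, hηv, Iso.hom_inv_id_assoc, Category.comp_id]

/-- The generic point of `W` lifts to the generic fibre, whose topology is induced from `W`, so the
lift lies in every nonempty open set. -/
theorem isIntegral_pullback_genericInclusion {W Z : Scheme.{u}} [IsIntegral W] [IsIntegral Z]
    (g : W ⟶ Z) [Smooth g] : IsIntegral (pullback (genericInclusion Z) g) := by
  have : IsReduced (pullback (genericInclusion Z) g) :=
    isReduced_of_smooth (pullback.fst (genericInclusion Z) g)
  obtain ⟨ψ, hψ⟩ := exists_functionField_map g (map_genericPoint_of_flat g)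
  let q : Spec W.functionField ⟶ pullback (genericInclusion Z) g :=
    pullback.lift (Spec.map ψ) (genericInclusion W) hψ
  let v := q (IsLocalRing.closedPoint W.functionField)
  have hv : pullback.snd (genericInclusion Z) g v = genericPoint W := by
    refine (Scheme.Hom.comp_apply q _ _).symm.trans ?_
    rw [pullback.lift_snd, Scheme.fromSpecStalk_closedPoint]
  have hmem : ∀ O : Set ↥(pullback (genericInclusion Z) g), IsOpen O → O.Nonempty → v ∈ O := by
    intro O hO ⟨x, hx⟩
    obtain ⟨O', hO', rfl⟩ := (pullback.snd (genericInclusion Z) g).isEmbedding.isOpen_iff.mp hO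
    change pullback.snd (genericInclusion Z) g v ∈ O'
    rw [hv]
    exact ((genericPoint_spec W).mem_open_set_iff hO').mpr ⟨_, trivial, hx⟩
  have : IrreducibleSpace ↥(pullback (genericInclusion Z) g) :=
    { isPreirreducible_univ := fun O₁ O₂ h₁ h₂ ⟨x, _, hx⟩ ⟨y, _, hy⟩ =>
        ⟨v, trivial, hmem O₁ h₁ ⟨x, hx⟩, hmem O₂ h₂ ⟨y, hy⟩⟩
      toNonempty := ⟨v⟩ }
  exact isIntegral_of_irreducibleSpace_of_isReduced _

/-- Normalisation commutes with smooth base change. -/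
theorem exists_iso_pullback_fromNormalization {W Z : Scheme.{u}} [IsIntegral W] [IsIntegral Z]
    (g : W ⟶ Z) [Smooth g] :
    ∃ e : pullback (genericInclusion Z).fromNormalization g ≅ (genericInclusion W).normalization,
      e.hom ≫ (genericInclusion W).fromNormalization = pullback.snd _ _ := by
  have := isIntegral_pullback_genericInclusion g
  set V := pullback (genericInclusion Z) g with hV
  let j : V ⟶ W := pullback.snd (genericInclusion Z) g
  have hn : IsNormal V := isNormal_of_smooth (isNormal_spec Z.functionField)
    (pullback.fst (genericInclusion Z) g)
  -- Base change gives the normalisation of `W` in the generic fibre `V`; as `V` is normal, this is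
  -- the normalisation in the generic point.
  have := isIso_fromNormalization_iff.mpr hn
  obtain ⟨φ, hφ⟩ := exists_iso_functionField_of_flat_of_mono j
  obtain ⟨e, he⟩ := exists_iso_normalization (genericInclusion V) j φ (genericInclusion W) hφ
  refine ⟨(asIso ((genericInclusion Z).normalizationPullback g)).symm ≪≫ e, ?_⟩
  rw [Iso.trans_hom, Category.assoc, he, Iso.symm_hom, asIso_inv, IsIso.inv_comp_eq]
  exact (Scheme.Hom.normalizationPullback_snd _ _).symm

theorem IsNormalization.of_isPullback {Z' Z W W' : Scheme.{u}} [IsIntegral W] [IsIntegral Z]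
    {g : W ⟶ Z} [Smooth g] {ν : Z' ⟶ Z} {ν' : W' ⟶ W} {g' : W' ⟶ Z'} (h : IsPullback g' ν' ν g)
    (hν : IsNormalization ν) : IsNormalization ν' := by
  obtain ⟨e, he⟩ := hν
  obtain ⟨d, hd⟩ := exists_iso_pullback_fromNormalization g
  have hp : IsPullback (g' ≫ e.hom) ν' (genericInclusion Z).fromNormalization g :=
    h.of_iso (Iso.refl _) e (Iso.refl _) (Iso.refl _) (by simp) (by simp) (by simp [he]) (by simp)
  refine ⟨hp.isoPullback ≪≫ d, ?_⟩
  rw [Iso.trans_hom, Category.assoc, hd, hp.isoPullback_hom_snd]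

theorem IsNormalization.isIntegral {Z' Z : Scheme.{u}} [IsIntegral Z] {ν : Z' ⟶ Z}
    (h : IsNormalization ν) : IsIntegral Z' := by
  obtain ⟨e, -⟩ := h
  have : Nonempty Z' := ⟨e.inv (genericPoint _)⟩
  exact isIntegral_of_isOpenImmersion e.hom

end Normalization

/-! ### Base change along height-one extensions -/

section PurelyInseparable

/-- Two maps from `l` to a field that agree on `k` agree on `p`-th powers, and Frobenius is
injective on a field. -/
theorem universallyInjective_specMap {p : ℕ} [Fact p.Prime] {k l : Type u} [Field k] [CharP k p]
    [CommRing l] [Algebra k l] (h : ∀ x : l, x ^ p ∈ (algebraMap k l).range) :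
    UniversallyInjective (specMap k l) := by
  refine ((tfae_universallyInjective (specMap k l)).out 1 0).mp ?_
  intro K _ g₁ g₂ hg
  obtain ⟨α, rfl⟩ := Spec.map_surjective g₁
  obtain ⟨β, rfl⟩ := Spec.map_surjective g₂
  simp only [← Spec.map_comp] at hg
  have hg := CommRingCat.hom_ext_iff.mp (Spec.map_injective hg)
  let : Algebra k K := (α.hom.comp (algebraMap k l)).toAlgebra
  have : CharP K p := charP_of_injective_algebraMap (algebraMap k K).injective p
  congr 1
  ext x
  obtain ⟨c, hc⟩ := h x
  refine frobenius_inj K p ?_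
  change (α.hom x) ^ p = (β.hom x) ^ p
  rw [← map_pow, ← map_pow, ← hc]
  exact congr($hg c)

theorem isIntegralHom_specMap {k l : Type u} [CommRing k] [CommRing l] [Algebra k l]
    [Algebra.IsIntegral k l] : IsIntegralHom (specMap k l) :=
  IsIntegralHom.SpecMap_iff.mpr fun x => Algebra.IsIntegral.isIntegral x

theorem isIntegral_of_pow_mem {p : ℕ} (hp : p ≠ 0) {k l : Type*} [CommRing k] [CommRing l]
    [Algebra k l] (h : ∀ x : l, x ^ p ∈ (algebraMap k l).range) : Algebra.IsIntegral k l := by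
  refine ⟨fun x => ?_⟩
  obtain ⟨c, hc⟩ := h x
  exact IsIntegral.of_pow (Nat.pos_of_ne_zero hp) (hc ▸ isIntegral_algebraMap)

/-- A reduced base change of an integral scheme along a purely inseparable extension of height one
is integral. -/
theorem isIntegral_of_isPullback_specMap {p : ℕ} [Fact p.Prime] {k l : Type u} [Field k] [CharP k p]
    [Field l] [Algebra k l] (h : ∀ x : l, x ^ p ∈ (algebraMap k l).range) {W X : Scheme.{u}}
    [IsIntegral X] [IsReduced W] {a : W ⟶ X} {b : W ⟶ Spec (CommRingCat.of l)}
    {s : X ⟶ Spec (CommRingCat.of k)} (hW : IsPullback a b s (specMap k l)) : IsIntegral W := by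
  have := universallyInjective_specMap h
  have := isIntegral_of_pow_mem (Fact.out : p.Prime).ne_zero h
  have : IsIntegralHom (specMap k l) := isIntegralHom_specMap
  have : Surjective (specMap k l) :=
    ⟨fun x => ⟨IsLocalRing.closedPoint l, Subsingleton.elim (α := PrimeSpectrum k) _ _⟩⟩
  have : UniversallyInjective a :=
    MorphismProperty.of_isPullback (P := @UniversallyInjective) hW.flip inferInstance
  have : IsIntegralHom a :=
    MorphismProperty.of_isPullback (P := @IsIntegralHom) hW.flip inferInstance
  have : Surjective a :=
    MorphismProperty.of_isPullback (P := @Surjective) hW.flip inferInstance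
  have ha : IsHomeomorph a := isHomeomorph_iff_continuous_isClosedMap_bijective.mpr
    ⟨a.continuous, a.isClosedMap, a.injective, a.surjective⟩
  have : IrreducibleSpace W := (ha.homeomorph).symm.surjective.irreducibleSpace
    (ha.homeomorph).symm.continuous
  exact isIntegral_of_irreducibleSpace_of_isReduced W

end PurelyInseparable

/-! ### Maps of function fields and their constants -/

section FunctionField

theorem toFunctionField_comp {k C : Type u} [CommRing k] [CommRing C] {X : Scheme.{u}}
    [IsIntegral X] (s : X ⟶ Spec (CommRingCat.of k)) (θ : X.functionField →+* C) :
    Spec.map (CommRingCat.ofHom (θ.comp (toFunctionField s))) =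
      Spec.map (CommRingCat.ofHom θ) ≫ genericInclusion X ≫ s := by
  rw [← specMap_toFunctionField, ← Spec.map_comp]
  rfl

theorem toFunctionField_comp_eq {k l C : Type u} [CommRing k] [CommRing l] [Algebra k l]
    [CommRing C] {X Y : Scheme.{u}} [IsIntegral X] [IsIntegral Y]
    {s : X ⟶ Spec (CommRingCat.of k)} {t : Y ⟶ Spec (CommRingCat.of l)}
    {f : Y ⟶ X} (h : f ≫ s = t ≫ specMap k l) {α : X.functionField →+* C}
    {β : Y.functionField →+* C}
    (hαβ : Spec.map (CommRingCat.ofHom α) ≫ genericInclusion X =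
      Spec.map (CommRingCat.ofHom β) ≫ genericInclusion Y ≫ f) :
    α.comp (toFunctionField s) = β.comp ((toFunctionField t).comp (algebraMap k l)) := by
  refine congrArg CommRingCat.Hom.hom (Spec.map_injective
    (a₁ := CommRingCat.ofHom _) (a₂ := CommRingCat.ofHom _) ?_)
  rw [toFunctionField_comp, reassoc_of% hαβ, h, ← Category.assoc (genericInclusion Y),
    ← specMap_toFunctionField, ← Spec.map_comp, ← Spec.map_comp]
  rfl

/-- A morphism from the spectrum of a field hitting the generic point is induced by a map from the
function field. -/
theorem exists_map_genericInclusion {X : Scheme.{u}} [IsIntegral X] {C : Type u} [Field C]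
    (q : Spec (CommRingCat.of C) ⟶ X) [hq : IsDominant q] :
    ∃ θ : X.functionField →+* C, Spec.map (CommRingCat.ofHom θ) ≫ genericInclusion X = q := by
  have hη : q (IsLocalRing.closedPoint C) = genericPoint X := by
    refine IsGenericPoint.eq ?_ (genericPoint_spec X)
    have h := q.denseRange.closure_range
    have : Set.range q = {q (IsLocalRing.closedPoint C)} := by
      refine Set.eq_singleton_iff_unique_mem.mpr ⟨⟨_, rfl⟩, ?_⟩
      rintro _ ⟨y, rfl⟩
      exact congrArg q (Subsingleton.elim (α := PrimeSpectrum C) _ _)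
    rwa [this] at h
  have h := Scheme.Spec_stalkClosedPointTo_fromSpecStalk (R := CommRingCat.of C) q
  revert h
  -- The stalk map must be generalised before its base point can be rewritten to the generic point.
  generalize Scheme.stalkClosedPointTo (R := CommRingCat.of C) q = φ
  revert φ
  rw [hη]
  exact fun φ h => ⟨φ.hom, h⟩

/-- `K(X ×ₖ l) ^ p ⊆ K(X)` if `l ^ p ⊆ k`. -/
theorem pow_mem_range_functionField {p : ℕ} [Fact p.Prime] {k l : Type u} [Field k] [CharP k p]
    [Field l] [Algebra k l] (h : ∀ x : l, x ^ p ∈ (algebraMap k l).range) {Z Y : Scheme.{u}}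
    [IsIntegral Y] [IsIntegral Z] {a : Z ⟶ Y} {b : Z ⟶ Spec (CommRingCat.of l)}
    {s : Y ⟶ Spec (CommRingCat.of k)} (hZ : IsPullback a b s (specMap k l))
    {θ : Y.functionField →+* Z.functionField}
    (hθ : Spec.map (CommRingCat.ofHom θ) ≫ genericInclusion Y = genericInclusion Z ≫ a)
    (x : Z.functionField) : x ^ p ∈ θ.range := by
  have : CharP Z.functionField p :=
    charP_of_injective_ringHom (f := θ.comp (toFunctionField s)) (RingHom.injective _) p
  have hcomp : θ.comp (toFunctionField s) = (toFunctionField b).comp (algebraMap k l) :=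
    toFunctionField_comp_eq (β := RingHom.id _) hZ.w
      (hθ.trans (by simp only [CommRingCat.ofHom_id, Spec.map_id]; exact (Category.id_comp _).symm))
  -- This subfield contains the images of `K(Y)` and `l`. Maps out of `K(Z)` are determined on
  -- these, since `Z` is a fibre product and its generic inclusion is a monomorphism.
  suffices powSubfield p θ = ⊤ from mem_powSubfield.mp (this ▸ Subfield.mem_top x)
  refine Subfield.eq_top_of_epi _ fun C _ α β hαβ => ?_
  have h1 : α.comp θ = β.comp θ := by
    ext y
    exact congr($hαβ ⟨θ y, mem_powSubfield.mpr ⟨y ^ p, map_pow _ _ _⟩⟩)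
  have h2 : α.comp (toFunctionField b) = β.comp (toFunctionField b) := by
    ext y
    refine congr($hαβ ⟨toFunctionField b y, mem_powSubfield.mpr ?_⟩)
    obtain ⟨c, hc⟩ := h y
    refine ⟨toFunctionField s c, ?_⟩
    rw [← map_pow, ← hc]
    exact congr($hcomp c)
  have key : Spec.map (CommRingCat.ofHom α) ≫ genericInclusion Z =
      Spec.map (CommRingCat.ofHom β) ≫ genericInclusion Z := by
    refine hZ.hom_ext ?_ ?_
    · rw [Category.assoc, Category.assoc, ← hθ, ← Spec.map_comp_assoc, ← Spec.map_comp_assoc]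
      exact congrArg (fun γ => Spec.map (CommRingCat.ofHom γ) ≫ genericInclusion Y) h1
    · rw [Category.assoc, Category.assoc, ← toFunctionField_comp, ← toFunctionField_comp, h2]
  exact congrArg CommRingCat.Hom.hom (Spec.map_injective ((cancel_mono _).mp key))

end FunctionField

/-! ### Algebraic closures in function fields -/

section AlgebraicClosure

theorem isIntegral_of_isIntegral_of_comp {R S T : Type*} [CommRing R] [CommRing S] [CommRing T]
    (f : R →+* S) (g : S →+* T) (hf : f.IsIntegral) {x : T} (hx : g.IsIntegralElem x) :
    (g.comp f).IsIntegralElem x := by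
  algebraize [f, g, g.comp f]
  have : Algebra.IsIntegral R S := ⟨hf⟩
  exact isIntegral_trans (R := R) (A := S) x hx

theorem isIntegral_closureIn {R K : Type u} [CommRing R] [CommRing K] (g : R →+* K) :
    Algebra.IsIntegral R (closureIn g) := by
  refine ⟨fun x => ?_⟩
  let : Algebra R K := g.toAlgebra
  let φ : closureIn g →ₐ[R] K := { (closureIn g).subtype with commutes' := fun _ => rfl }
  exact (isIntegral_algHom_iff φ Subtype.val_injective).mp ((mem_closureIn _ _).mp x.2)

theorem isField_closureIn {R K : Type u} [CommRing R] [Field K] (g : R →+* K) (hR : IsField R) :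
    IsField (closureIn g) :=
  have := isIntegral_closureIn g
  isField_of_isIntegral_of_isField' hR

theorem closureIn_subtype_closureIn {R K : Type u} [CommRing R] [CommRing K] (g : R →+* K) :
    closureIn (closureIn g).subtype = closureIn g := by
  ext x
  refine ⟨fun hx => ?_, fun hx => (mem_closureIn _ _).mpr
    ((closureIn g).subtype.isIntegralElem_map (x := ⟨x, hx⟩))⟩
  have := isIntegral_closureIn g
  exact isIntegral_of_isIntegral_of_comp (algebraMap R (closureIn g)) _
    (fun x => Algebra.IsIntegral.isIntegral x) ((mem_closureIn _ _).mp hx)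

/-- In an elemental extension `k ⊆ l ⊆ k'` one has `k' ^ p ⊆ k`. -/
theorem IsElementalExtension.pow_mem_top {p : ℕ} {k l k' : Type u} [Field k] [Field l] [Field k']
    [Algebra k l] [Algebra l k'] [Algebra k k'] [IsScalarTower k l k'] {X X' : Scheme.{u}}
    [IsIntegral X] [IsIntegral X'] {s : X ⟶ Spec (CommRingCat.of k)} {φ : X' ⟶ X}
    {ν : X' ⟶ pullback s (specMap k l)} {ι : k' →+* X'.functionField}
    (h : IsElementalExtension p s φ ν ι) (x : k') : x ^ p ∈ (algebraMap k k').range := by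
  have := h.charP
  have : Fact p.Prime := ⟨h.prime⟩
  have := h.isIntegral_baseChange
  let Z := pullback s (specMap k l)
  let a : Z ⟶ X := pullback.fst s (specMap k l)
  let b : Z ⟶ Spec (CommRingCat.of l) := pullback.snd s (specMap k l)
  have : Flat a := inferInstanceAs (Flat (pullback.fst s (specMap k l)))
  obtain ⟨θ, hθ⟩ := exists_functionField_map a (map_genericPoint_of_flat a)
  obtain ⟨e, he⟩ := h.isNormalization
  let q : Spec (CommRingCat.of Z.functionField) ⟶ X' := (genericInclusion Z).toNormalization ≫ e.inv
  have : IsDominant q :=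
    inferInstanceAs (IsDominant ((genericInclusion Z).toNormalization ≫ e.inv))
  obtain ⟨τ, hτ⟩ := exists_map_genericInclusion q
  have hqν : q ≫ ν = genericInclusion Z := by
    rw [← he, Category.assoc, Iso.inv_hom_id_assoc, Scheme.Hom.toNormalization_fromNormalization]
  have hcomp : θ.hom.comp (toFunctionField s) =
      τ.comp ((toFunctionField (ν ≫ b)).comp (algebraMap k l)) := by
    refine toFunctionField_comp_eq (f := ν ≫ a) ?_ ?_
    · rw [Category.assoc, Category.assoc, pullback.condition]
    · rw [reassoc_of% hτ, reassoc_of% hqν]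
      exact hθ
  have hint : (algebraMap k l).IsIntegral := by
    have := isIntegral_of_pow_mem h.prime.ne_zero h.pow_mem
    exact fun x => Algebra.IsIntegral.isIntegral x
  obtain ⟨y, hy : θ.hom y = _⟩ :=
    pow_mem_range_functionField h.pow_mem (IsPullback.of_hasPullback _ _) hθ (τ (ι x))
  have h1 : (θ.hom.comp (toFunctionField s)).IsIntegralElem (θ.hom y) := by
    have hx : ι x ∈ closureIn (toFunctionField (ν ≫ b)) := h.range_eq ▸ ⟨x, rfl⟩
    have := isIntegral_of_isIntegral_of_comp _ _ hint ((mem_closureIn _ _).mp hx)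
    rw [hcomp, hy]
    have hx' := this.map τ
    let := (τ.comp ((toFunctionField (ν ≫ b)).comp (algebraMap k l))).toAlgebra
    exact IsIntegral.pow (R := k) hx' p
  -- `y` is the `p`-th power of `x`, viewed in `K(X)`. It is algebraic over `k`, so it lies in `k`.
  have h2 : y ∈ closureIn (toFunctionField s) := by
    obtain ⟨P, hP, hP'⟩ := h1
    refine ⟨P, hP, θ.hom.injective ?_⟩
    rwa [map_zero, Polynomial.hom_eval₂]
  rw [h.algClosed] at h2
  obtain ⟨c, rfl⟩ := h2
  refine ⟨c, ι.injective (τ.injective ?_)⟩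
  rw [map_pow, map_pow, ← hy, IsScalarTower.algebraMap_apply k l k']
  have h3 := h.comp_algebraMap
  exact (congr(τ ($h3 (algebraMap k l c)))).trans congr($hcomp c).symm

/-- If `Y` is normal and `k` is algebraically closed in `K(Y)`, then the algebraic closure of `k` in
the function field of a smooth `Y`-scheme is separable over `k`. -/
theorem isSeparable_closureInFunctionField {k : Type u} [Field k] {X Y : Scheme.{u}} [IsIntegral X]
    [IsIntegral Y] (hYn : IsNormal Y) (f : X ⟶ Y) [Smooth f] (s : Y ⟶ Spec (CommRingCat.of k))
    (hs : closureIn (toFunctionField s) = (toFunctionField s).range) :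
    Algebra.IsSeparable k (closureInFunctionField (f ≫ s)) := by
  obtain ⟨U, hU, V, hV, hx, e, hsm⟩ := Smooth.exists_isStandardSmooth f (genericPoint X)
  have : Nonempty V := ⟨⟨_, hx⟩⟩
  have hyU : f (genericPoint X) ∈ U := e hx
  have : Nonempty U := ⟨⟨_, hyU⟩⟩
  have hη : genericPoint Y ∈ U := map_genericPoint_of_flat f ▸ hyU
  let i : CommRingCat.of k ⟶ Γ(Y, U) :=
    (Scheme.ΓSpecIso (CommRingCat.of k)).inv ≫ s.appTop ≫ Y.presheaf.map (homOfLE le_top).op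
  let : Algebra k Γ(Y, U) := i.hom.toAlgebra
  let : Algebra Γ(Y, U) Γ(X, V) := (f.appLE U V e).hom.toAlgebra
  let : Algebra k X.functionField := (toFunctionField (f ≫ s)).toAlgebra
  have : IsFractionRing Γ(X, V) X.functionField :=
    functionField_isFractionRing_of_isAffineOpen _ V hV
  have := hYn.isIntegrallyClosed hU
  have hY : i ≫ Y.presheaf.germ U _ hη = CommRingCat.ofHom (toFunctionField s) := by
    simp only [i, Category.assoc, TopCat.Presheaf.germ_res]
    rfl
  have hXk : i ≫ f.appLE U V e ≫ X.presheaf.germ V _ hx =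
      CommRingCat.ofHom (toFunctionField (f ≫ s)) := by
    simp only [i, Category.assoc, Scheme.Hom.map_appLE_assoc]
    simp only [Scheme.Hom.appLE, Category.assoc, TopCat.Presheaf.germ_res]
    rfl
  have hcl : integralClosure k Γ(Y, U) = ⊥ := by
    refine eq_bot_iff.mpr fun a ha => ?_
    have hinj := germ_injective_of_isIntegral Y (U := U) (genericPoint Y) hη
    have : (Y.presheaf.germ U _ hη) a ∈ closureIn (toFunctionField s) := by
      have : (i.hom).IsIntegralElem a := ha
      have := this.map (Y.presheaf.germ U _ hη).hom
      rwa [← CommRingCat.hom_comp, hY] at this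
    rw [hs] at this
    obtain ⟨c, hc⟩ := this
    refine Algebra.mem_bot.mpr ⟨c, hinj (.trans ?_ hc)⟩
    exact congr($hY c)
  refine ⟨fun x => ?_⟩
  have hxi : _root_.IsIntegral k (x : X.functionField) := (mem_closureIn _ _).mp x.2
  have hsep : IsSeparable k (x : X.functionField) :=
    isSeparable_of_isStandardSmooth (A := Γ(Y, U)) (B := Γ(X, V)) congr(($hXk).hom) hsm hcl hxi
  let φ : closureInFunctionField (f ≫ s) →ₐ[k] X.functionField :=
    { (closureInFunctionField (f ≫ s)).subtype with commutes' := fun _ => rfl }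
  exact (isSeparable_map_iff φ Subtype.val_injective).mp hsep

/-- A normal scheme over `k` is a scheme over the algebraic closure of `k` in its function field. -/
theorem exists_structureMorphism {k : Type u} [CommRing k] {X : Scheme.{u}} [IsIntegral X]
    (hX : IsNormal X) (s : X ⟶ Spec (CommRingCat.of k)) :
    ∃ t : X ⟶ Spec (CommRingCat.of (closureInFunctionField s)),
      toFunctionField t = (closureInFunctionField s).subtype ∧
        t ≫ specMap k (closureInFunctionField s) = s := by
  set K := closureInFunctionField s
  have := isIso_fromNormalization_iff.mpr hX
  have : Algebra.IsIntegral k K := isIntegral_closureIn _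
  have : IsIntegralHom (specMap k K) := isIntegralHom_specMap
  let i : Spec X.functionField ⟶ Spec (CommRingCat.of K) := Spec.map (CommRingCat.ofHom K.subtype)
  have hi : genericInclusion X ≫ s = i ≫ specMap k K := by
    rw [← specMap_toFunctionField]
    exact Spec.map_comp (CommRingCat.ofHom (algebraMap k K)) (CommRingCat.ofHom K.subtype)
  let q : Spec X.functionField ⟶ pullback s (specMap k K) := pullback.lift _ _ hi
  -- `X ×ₖ K` is integral over `X` and receives `Spec K(X)`, so the normal scheme `X` maps to it.
  let n := (genericInclusion X).normalizationDesc q (pullback.fst s (specMap k K))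
    (pullback.lift_fst _ _ _).symm
  let t := inv (genericInclusion X).fromNormalization ≫ n ≫ pullback.snd s (specMap k K)
  have h1 : t ≫ specMap k K = s := by
    simp only [t, n, Category.assoc, ← pullback.condition,
      Scheme.Hom.normalizationDesc_comp_assoc, IsIso.inv_hom_id_assoc]
  have h2 : genericInclusion X ≫ t = i := by
    have : genericInclusion X ≫ inv (genericInclusion X).fromNormalization =
        (genericInclusion X).toNormalization := by
      rw [IsIso.comp_inv_eq, Scheme.Hom.toNormalization_fromNormalization]
    simp only [t, n, reassoc_of% this, Scheme.Hom.toNormalization_normalizationDesc_assoc, q,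
      pullback.lift_snd]
  refine ⟨t, ?_, h1⟩
  rw [← specMap_toFunctionField] at h2
  exact congrArg CommRingCat.Hom.hom (Spec.map_injective h2)

end AlgebraicClosure

/-! ### Degrees and fibre squares under base change -/

section BaseChange

/-- `(E ⊗ l) ⊗_l k' ≅ E ⊗ k'` is a field, so its map to `N` is injective; its rank over `E ⊗ l` is
`[k' : l]`. -/
theorem rank_le_rank_of_isField_tensorProduct {k l k' E N : Type u} [Field k] [Field l] [Field k']
    [Algebra k l] [Algebra l k'] [Algebra k k'] [IsScalarTower k l k'] [CommRing E] [Algebra k E]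
    [CommRing N] [Nontrivial N] [Algebra (E ⊗[k] l) N] (hF : IsField (E ⊗[k] k')) (σ : k' →+* N)
    (hσ : σ.comp (algebraMap l k') = (algebraMap (E ⊗[k] l) N).comp
      (Algebra.TensorProduct.includeRight : l →ₐ[k] E ⊗[k] l).toRingHom) :
    Module.rank l k' ≤ Module.rank (E ⊗[k] l) N := by
  let : Algebra l (E ⊗[k] l) := Algebra.TensorProduct.rightAlgebra
  let : Algebra l N := ((algebraMap (E ⊗[k] l) N).comp (algebraMap l (E ⊗[k] l))).toAlgebra
  have : IsScalarTower l (E ⊗[k] l) N := .of_algebraMap_eq fun _ => rfl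
  have : Nontrivial (E ⊗[k] l) := (algebraMap (E ⊗[k] l) N).domain_nontrivial
  let σ' : k' →ₐ[l] N := { σ with commutes' := fun x => congr($hσ x) }
  let e : E ⊗[k] l ≃ₐ[l] l ⊗[k] E :=
    { Algebra.TensorProduct.comm k E l with commutes' := fun _ => rfl }
  let e' : (E ⊗[k] l) ⊗[l] k' ≃+* E ⊗[k] k' :=
    ((Algebra.TensorProduct.comm l (E ⊗[k] l) k').trans
      (Algebra.TensorProduct.congr .refl e)).toRingEquiv.trans
    ((Algebra.TensorProduct.cancelBaseChange k l l k' E).toRingEquiv.trans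
      (Algebra.TensorProduct.comm k k' E).toRingEquiv)
  have hF' : IsField ((E ⊗[k] l) ⊗[l] k') := e'.toMulEquiv.isField hF
  let Φ : (E ⊗[k] l) ⊗[l] k' →ₐ[E ⊗[k] l] N :=
    Algebra.TensorProduct.lift (Algebra.ofId _ N) σ' fun _ _ => .all _ _
  have hΦ : Function.Injective Φ := by
    have := (isSimpleRing_iff_isField _).mpr hF'
    exact Φ.toRingHom.injective
  have h := LinearMap.rank_le_of_injective Φ.toLinearMap hΦ
  rwa [Module.rank_baseChange, Cardinal.lift_id] at h

/-- Pasting squares: `W = Z ×_Y X`, hence `Y' ×_Y X = Y' ×_Z W`. -/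
theorem exists_isPullback_of_isPullback {X Y Z W Y' S T : Scheme.{u}} {a : Z ⟶ Y} {b : Z ⟶ T}
    {s : Y ⟶ S} {m : T ⟶ S} {c : W ⟶ X} {d : W ⟶ T} {f : X ⟶ Y} (hZ : IsPullback a b s m)
    (hW : IsPullback c d (f ≫ s) m) {ψ : Y' ⟶ Y} {ν : Y' ⟶ Z} (hν : ν ≫ a = ψ) :
    ∃ (g : W ⟶ Z) (ν' : pullback ψ f ⟶ W), IsPullback g c a f ∧ ν' ≫ c = pullback.snd ψ f ∧
      ν' ≫ d = pullback.fst ψ f ≫ ν ≫ b ∧ IsPullback (pullback.fst ψ f) ν' ν g := by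
  let g : W ⟶ Z := hZ.lift (c ≫ f) d (by rw [Category.assoc, hW.w])
  have hga : g ≫ a = c ≫ f := hZ.lift_fst _ _ _
  have hgb : g ≫ b = d := hZ.lift_snd _ _ _
  have hg : IsPullback g c a f := by
    refine (IsPullback.of_bot (v₂₁ := b) (v₂₂ := s) (h₃₁ := m) ?_ hga.symm hZ).flip
    rwa [hgb]
  let ν' : pullback ψ f ⟶ W := hg.lift (pullback.fst ψ f ≫ ν) (pullback.snd ψ f)
    (by rw [Category.assoc, hν, pullback.condition])
  have hc : ν' ≫ c = pullback.snd ψ f := hg.lift_snd _ _ _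
  have hgν : ν' ≫ g = pullback.fst ψ f ≫ ν := hg.lift_fst _ _ _
  refine ⟨g, ν', hg, hc, ?_, ?_⟩
  · rw [← hgb, reassoc_of% hgν]
  · refine IsPullback.of_bot (v₂₁ := c) (v₂₂ := a) (h₃₁ := f) ?_ hgν.symm hg
    rw [hc, hν]
    exact .of_hasPullback _ _

end BaseChange

end Elemental

/-! ### The proposition -/

open Elemental in
theorem mainTheorem7 (p : ℕ)
    {kY lY kY' : Type u} [Field kY] [Field lY] [Field kY']
    [Algebra kY lY] [Algebra lY kY'] [Algebra kY kY'] [IsScalarTower kY lY kY']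
    {X Y Y' : Scheme.{u}} [IsIntegral X] [IsIntegral Y] [IsIntegral Y']
    (sX : X ⟶ Spec (CommRingCat.of kY)) (sY : Y ⟶ Spec (CommRingCat.of kY))
    (hX : IsVariety sX) (hXn : IsNormal X) (hYn : IsNormal Y)
    (f : X ⟶ Y) [Smooth f] (hf : f ≫ sY = sX)
    (ψ : Y' ⟶ Y) (νY : Y' ⟶ pullback sY (specMap kY lY)) (ιY : kY' →+* Y'.functionField)
    (hY : IsElementalExtension p sY ψ νY ιY) :
    let kX := closureInFunctionField sX
    let lX := kX ⊗[kY] lY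
    -- (1)
    (IsField lX ∧ IsField (kX ⊗[kY] kY')) ∧
    -- the structure morphism of `X` over `kX`
    ∃ tX : X ⟶ Spec (CommRingCat.of kX),
      toFunctionField tX = kX.subtype ∧ tX ≫ specMap kY kX = sX ∧
      -- the induced morphism `X' = Y' ×_Y X ⟶ X ×_{kX} lX`
      ∃ νX : pullback ψ f ⟶ pullback tX (specMap kX lX),
        νX ≫ pullback.fst tX (specMap kX lX) = pullback.snd ψ f ∧
        νX ≫ pullback.snd tX (specMap kX lX) ≫
            Spec.map (CommRingCat.ofHom
              (Algebra.TensorProduct.includeRight : lY →ₐ[kY] lX).toRingHom) =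
          pullback.fst ψ f ≫ νY ≫ pullback.snd sY (specMap kY lY) ∧
        -- (2)
        ∃ (_ : IsIntegral (pullback ψ f)) (_ : IsIntegral (pullback tX (specMap kX lX))),
          let kX' := closureInFunctionField (νX ≫ pullback.snd tX (specMap kX lX))
          IsNormalization νX ∧
          -- (3)
          IsElementalExtension p tX (pullback.snd ψ f) νX kX'.subtype ∧
          -- (4)
          Module.rank kX lX = Module.rank kY lY ∧
          Module.rank lY kY' ≤ Module.rank lX kX' ∧
          -- (5)
          (IsNormal (pullback sY (specMap kY lY)) → IsNormal (pullback tX (specMap kX lX))) ∧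
          -- (6)
          (Surjective f → IsNormal (pullback tX (specMap kX lX)) →
            IsNormal (pullback sY (specMap kY lY))) := by
  subst hf
  intro kX lX
  have : Fact p.Prime := ⟨hY.prime⟩
  have := hY.charP
  have := hY.isIntegral_baseChange
  have hkX : IsField kX := isField_closureIn _ (Field.toIsField kY)
  have hsep : Algebra.IsSeparable kY kX := isSeparable_closureInFunctionField hYn f sY hY.algClosed
  have hlX : IsField lX := by
    let := hkX.toField
    exact isField_tensorProduct (p := p) hY.pow_mem
  have hkXkY' : IsField (kX ⊗[kY] kY') := by
    let := hkX.toField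
    exact isField_tensorProduct (p := p) hY.pow_mem_top
  refine ⟨⟨hlX, hkXkY'⟩, ?_⟩
  obtain ⟨tX, htX, htX'⟩ := exists_structureMorphism hXn (f ≫ sY)
  -- This identifies `X ×_{kX} lX` with `X ×_{kY} lY`.
  have hW := (IsPullback.of_hasPullback tX (specMap kX lX)).paste_vert
    (isPullback_SpecMap_of_isPushout _ _ _ _ (CommRingCat.isPushout_tensorProduct kY kX lY))
  rw [htX'] at hW
  obtain ⟨g, νX, hg, hν₁, hν₂, hνX⟩ :=
    exists_isPullback_of_isPullback (IsPullback.of_hasPullback _ _) hW hY.comp_fst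
  have : Smooth g := MorphismProperty.of_isPullback (P := @Smooth) hg.flip inferInstance
  have := isReduced_of_smooth g
  have hWint : IsIntegral (pullback tX (specMap kX lX)) :=
    isIntegral_of_isPullback_specMap hY.pow_mem hW
  have hνn : IsNormalization νX := .of_isPullback hνX hY.isNormalization
  have hX'int : IsIntegral (pullback ψ f) := hνn.isIntegral
  refine ⟨tX, htX, htX', νX, hν₁, (Category.assoc _ _ _).symm.trans hν₂, hX'int, hWint, ?_⟩
  intro kX'
  have hpow : ∀ x : lX, x ^ p ∈ (algebraMap kX lX).range := fun x => by
    obtain ⟨c, hc⟩ := exists_pow_tensorProduct hY.pow_mem x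
    exact ⟨c, hc⟩
  have hcharX : CharP kX p := charP_of_injective_ringHom (algebraMap kY kX).injective p
  refine ⟨hνn, ?_, ?_, ?_, fun h => hνn.isIso_iff.mp ?_, fun hs h => ?_⟩
  · have hlXint := isIntegral_of_pow_mem hY.prime.ne_zero hpow
    have hpi : IsPurelyInseparable kX lX := by
      let := hkX.toField
      let := hlX.toField
      exact (isPurelyInseparable_iff_pow_mem kX p).mpr fun x => ⟨1, by simpa using hpow x⟩
    have hvar : IsVariety tX := by
      rw [← htX'] at hX
      have := hX.isSeparated
      have := hX.locallyOfFiniteType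
      have := hX.quasiCompact
      exact ⟨hX.isIntegral, .of_comp tX (specMap kY kX),
        locallyOfFiniteType_of_comp tX (specMap kY kX), .of_comp tX (specMap kY kX)⟩
    refine ⟨hkX, hY.prime, hcharX, hvar, ?_, hlX, ?_, hpi, hpow, hWint, hνn, hν₁, rfl,
      Subring.range_subtype _⟩
    · rw [htX, Subring.range_subtype]
      exact closureIn_subtype_closureIn _
    · exact isField_closureIn _ hlX
  · rw [Module.rank_baseChange, Cardinal.lift_id]
  · have : Flat (pullback.fst ψ f) := inferInstance
    obtain ⟨θ, hθ⟩ := exists_functionField_map _ (map_genericPoint_of_flat (pullback.fst ψ f))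
    set tY' := νY ≫ pullback.snd sY (specMap kY lY)
    set tX' := νX ≫ pullback.snd tX (specMap kX lX)
    let i : lY →+* lX := (Algebra.TensorProduct.includeRight : lY →ₐ[kY] lX).toRingHom
    have hcomp : θ.hom.comp (toFunctionField tY') = (toFunctionField tX').comp i := by
      let : Algebra lY lX := i.toAlgebra
      refine toFunctionField_comp_eq (β := .id _) (f := pullback.fst ψ f) ?_ ?_
      · exact (hν₂.symm.trans (Category.assoc _ _ _).symm)
      · refine hθ.trans ?_
        rw [CommRingCat.ofHom_id, Spec.map_id]
        exact (Category.id_comp _).symm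
    -- An integral equation over `lY` pushes forward to one over `lX`.
    have hmem (x : kY') : θ.hom (ιY x) ∈ kX' := by
      have hx : ιY x ∈ closureIn (toFunctionField tY') := hY.range_eq ▸ ⟨x, rfl⟩
      obtain ⟨P, hP, hx⟩ := ((mem_closureIn _ _).mp hx).map θ.hom
      exact (mem_closureIn _ _).mpr ⟨P.map i, hP.map i, by rwa [Polynomial.eval₂_map, ← hcomp]⟩
    refine rank_le_rank_of_isField_tensorProduct hkXkY' ((θ.hom.comp ιY).codRestrict kX' hmem) ?_
    ext x
    exact congr(θ.hom ($hY.comp_algebraMap x)).trans congr($hcomp x)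
  · have := hY.isNormalization.isIso_iff.mpr h
    exact MorphismProperty.of_isPullback (P := .isomorphisms Scheme) hνX ‹IsIso νY›
  · have := hνn.isIso_iff.mpr h
    refine hY.isNormalization.isIso_iff.mp ?_
    have : Surjective g := MorphismProperty.of_isPullback (P := @Surjective) hg.flip inferInstance
    -- Being an isomorphism descends along `g`, which is flat, surjective and locally of finite
    -- presentation.
    exact MorphismProperty.of_isPullback_of_descendsAlong (P := .isomorphisms Scheme)
      (Q := @Surjective ⊓ @Flat ⊓ @LocallyOfFinitePresentation) hνX.flip
      ⟨⟨inferInstance, inferInstance⟩, inferInstance⟩ ‹IsIso νX›
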